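/- Let $S_n$ be the symmetric group. For a partition $\nu\vdash n$ let $\chi^\nu$ be the irreducible character of $S_n$ indexed by $\nu$ and $f^\nu=\dim\chi^\nu$ (the number of standard Young tableaux of shape $\nu$). For a partition $\lambda=(1^{m_1}2^{m_2}\cdots)\vdash n$, the centralizer $Z_\lambda$ of a permutation of cycle type $\lambda$ is a product of wreath products of cyclic groups $\mathbb Z/i$ with $S_{m_i}$, and the higher Lie character $\psi^\lambda$ is induced from $Z_\lambda$ to $S_n$ from the linear character that is trivial on each $S_{m_i}$ and is a primitive character on each copy of $\mathbb Z/i$. The Plancherel measure is the probability measure on infinite increasing sequences $\nu=(\nu^{(1)}\subset\nu^{(2)}\subset\cdots)$ of Young diagrams with $\nu^{(n)}\vdash n$ for which every increasing initial segment $(\nu^{(1)},\dots,\nu^{(n)})$ has probability $f^{\nu^{(n)}}/n!$. For integers $n_k\to\infty$, a sequence of characters $\rho_k$ of $S_{n_k}$ is said to tend to be regular if, for Plancherel-almost every $\nu$, $$\frac{\langle\rho_k,\chi^{\nu^{(n_k)}}\rangle}{\dim\rho_k}\sim\frac{f^{\nu^{(n_k)}}}{n_k!}\qquad(k\to\infty).$$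 Proposition. The sequence of higher Lie characters $\psi^{(2^k)}$ of $S_{2k}$, indexed by the rectangular diagrams $(2^k)$ with $k$ rows of length $2$, $k\to\infty$, does not tend to be regular. Moreover, for Plancherel-almost every $\nu$ the asymptotic relation $$\frac{\langle\psi^{(2^k)},\chi^{\nu^{(2k)}}\rangle}{\dim\psi^{(2^k)}}\sim\frac{f^{\nu^{(2k)}}}{(2k)!}\qquad(k\to\infty)$$ fails. -/

import Mathlib

open scoped ENNReal Asymptotics
open Filter MeasureTheory ProbabilityTheory

noncomputable section

namespace HigherLie

/-! ### Young diagrams with `n` cells -/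

/-- Young diagrams with `n` cells, identified with the partitions of `n`. -/
abbrev Diagram (n : ℕ) : Type := {μ : YoungDiagram // μ.card = n}

theorem mem_lt {n : ℕ} (μ : Diagram n) {i j : ℕ} (h : (i, j) ∈ μ.1) : i < n ∧ j < n := by
  constructor
  · have hs : (Finset.range (i + 1)).image (fun a => (a, j)) ⊆ μ.1.cells := by
      intro c hc
      obtain ⟨a, ha, rfl⟩ := Finset.mem_image.1 hc
      exact μ.1.up_left_mem (Nat.lt_succ_iff.1 (Finset.mem_range.1 ha)) le_rfl h
    have := Finset.card_le_card hs
    rw [Finset.card_image_of_injective _ (fun a b hab => (Prod.mk.inj hab).1),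
      Finset.card_range] at this
    have h2 := μ.2
    simp only [YoungDiagram.card] at h2
    omega
  · have hs : (Finset.range (j + 1)).image (fun a => (i, a)) ⊆ μ.1.cells := by
      intro c hc
      obtain ⟨a, ha, rfl⟩ := Finset.mem_image.1 hc
      exact μ.1.up_left_mem le_rfl (Nat.lt_succ_iff.1 (Finset.mem_range.1 ha)) h
    have := Finset.card_le_card hs
    rw [Finset.card_image_of_injective _ (fun a b hab => (Prod.mk.inj hab).2),
      Finset.card_range] at this
    have h2 := μ.2
    simp only [YoungDiagram.card] at h2
    omega

instance (n : ℕ) : Finite (Diagram n) := by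
  let F : Diagram n → (Finset.range n ×ˢ Finset.range n).powerset := fun μ =>
    ⟨μ.1.cells, by
      rw [Finset.mem_powerset]
      rintro ⟨i, j⟩ h
      have := mem_lt μ h
      simp [this.1, this.2]⟩
  refine Finite.of_injective F ?_
  intro a b hab
  exact Subtype.ext (YoungDiagram.ext (congrArg Subtype.val hab))

instance (n : ℕ) : Fintype (Diagram n) := Fintype.ofFinite _

instance (n : ℕ) : MeasurableSpace (Diagram n) := ⊤

instance (n : ℕ) : DiscreteMeasurableSpace (Diagram n) := ⟨fun _ => trivial⟩

/-- The empty diagram. -/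
def emptyDiagram : Diagram 0 := ⟨⊥, rfl⟩

/-- The rectangular diagram `(m ^ k)`, with `k` rows of length `m`. -/
def rectangle (m k : ℕ) : Diagram (m * k) :=
  ⟨{ cells := Finset.range k ×ˢ Finset.range m
     isLowerSet := by
       rintro ⟨a, b⟩ ⟨c, d⟩ h hab
       have h1 := (Prod.mk_le_mk.1 h).1
       have h2 := (Prod.mk_le_mk.1 h).2
       simp only [Finset.coe_product, Finset.coe_range, Set.mem_prod, Set.mem_Iio] at hab ⊢
       omega },
    by simp [YoungDiagram.card, mul_comm]⟩

/-! ### Characters of the symmetric group -/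

/-- The inner product `⟨φ, ψ⟩ = (1 / n!) ∑ g, φ g * ψ g⁻¹` of characters of `S_n`. -/
def charInner {n : ℕ} (φ ψ : Equiv.Perm (Fin n) → ℂ) : ℂ :=
  (n.factorial : ℂ)⁻¹ * ∑ g : Equiv.Perm (Fin n), φ g * ψ g⁻¹

/-- A bijective filling of the cells of `ν` with the labels `0, …, n - 1`. -/
def filling {n : ℕ} (ν : Diagram n) : {c : ℕ × ℕ // c ∈ ν.1.cells} ≃ Fin n :=
  Finset.equivFinOfCardEq ν.2

open Classical in
/-- The sum `a_ν` of the permutations that preserve every row of the filling of `ν`. -/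
def rowSum {n : ℕ} (ν : Diagram n) : MonoidAlgebra ℂ (Equiv.Perm (Fin n)) :=
  ∑ p : Equiv.Perm (Fin n) with
      ∀ x, ((filling ν).symm (p x)).1.1 = ((filling ν).symm x).1.1,
    MonoidAlgebra.single p 1

open Classical in
/-- The signed sum `b_ν` of the permutations that preserve every column of the filling of `ν`. -/
def colSum {n : ℕ} (ν : Diagram n) : MonoidAlgebra ℂ (Equiv.Perm (Fin n)) :=
  ∑ q : Equiv.Perm (Fin n) with
      ∀ x, ((filling ν).symm (q x)).1.2 = ((filling ν).symm x).1.2,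
    MonoidAlgebra.single q ((Equiv.Perm.sign q : ℤ) : ℂ)

/-- The Specht module of `ν`: the left ideal of `ℂ[S_n]` generated by the Young symmetrizer
`a_ν * b_ν`. -/
abbrev SpechtModule {n : ℕ} (ν : Diagram n) : Type :=
  ↥(Ideal.span {rowSum ν * colSum ν} : Ideal (MonoidAlgebra ℂ (Equiv.Perm (Fin n))))

/-- The irreducible representation of `S_n` indexed by `ν`: left multiplication on the Specht
module. -/
def spechtRep {n : ℕ} (ν : Diagram n) :
    Representation ℂ (Equiv.Perm (Fin n)) (SpechtModule ν) :=
  Representation.ofModule' (SpechtModule ν)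

/-- The irreducible character `χ^ν` of `S_n`. -/
def irrChar {n : ℕ} (ν : Diagram n) : Equiv.Perm (Fin n) → ℂ :=
  (spechtRep ν).character

/-! ### Higher Lie characters -/

theorem rowLen_pos (μ : YoungDiagram) (i : Fin (μ.colLen 0)) : 0 < μ.rowLen i := by
  have h : ((i : ℕ), 0) ∈ μ := YoungDiagram.mem_iff_lt_colLen.2 i.2
  exact YoungDiagram.mem_iff_lt_rowLen.1 h

instance (μ : YoungDiagram) (i : Fin (μ.colLen 0)) : NeZero (μ.rowLen i) :=
  ⟨(rowLen_pos μ i).ne'⟩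

/-- The disjoint union of cyclic groups `ℤ / μ_i`, one for each row `i` of `μ`. -/
abbrev CyclicRows (μ : YoungDiagram) : Type :=
  Σ i : Fin (μ.colLen 0), ZMod (μ.rowLen i)

theorem card_cyclicRows {n : ℕ} (μ : Diagram n) : Fintype.card (CyclicRows μ.1) = n := by
  rw [Fintype.card_sigma]
  simp only [ZMod.card]
  refine Eq.trans ?_ μ.2
  rw [YoungDiagram.card,
    Finset.card_eq_sum_card_fiberwise (f := Prod.fst) (t := Finset.range (μ.1.colLen 0)),
    Finset.sum_range]
  · refine Finset.sum_congr rfl fun i _ => ?_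
    rw [YoungDiagram.rowLen_eq_card]
    rfl
  · rintro ⟨i, j⟩ h
    simp only [Finset.coe_range, Set.mem_Iio]
    exact YoungDiagram.mem_iff_lt_colLen.1 (μ.1.up_left_mem le_rfl (Nat.zero_le j) h)

/-- The permutation `x ↦ x + 1` on each cyclic row; its cycle type is `μ`. -/
def rowCycle (μ : YoungDiagram) : Equiv.Perm (CyclicRows μ) :=
  Equiv.sigmaCongrRight fun _ => Equiv.addRight 1

/-- The centralizer `Z_μ` of a permutation of cycle type `μ`. -/
abbrev rowCentralizer (μ : YoungDiagram) : Subgroup (Equiv.Perm (CyclicRows μ)) :=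
  Subgroup.centralizer {rowCycle μ}

/-- The value `exp (2 π i x / μ_i)` at an element `x` of the cyclic row `ℤ / μ_i`. -/
def rowPhase (μ : YoungDiagram) (x : CyclicRows μ) : ℂ := ZMod.stdAddChar x.2

theorem rowPhase_zero (μ : YoungDiagram) (i : Fin (μ.colLen 0)) : rowPhase μ ⟨i, 0⟩ = 1 :=
  AddChar.map_zero_eq_one _

theorem rowCycle_pow (μ : YoungDiagram) (t : ℕ) (x : CyclicRows μ) :
    (rowCycle μ ^ t) x = ⟨x.1, x.2 + t⟩ := by
  induction t with
  | zero => simp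
  | succ t ih =>
    rw [pow_succ', Equiv.Perm.mul_apply, ih]
    simp [rowCycle, add_assoc]

theorem centralizer_apply (μ : YoungDiagram) (g : rowCentralizer μ) (t : ℕ) (x : CyclicRows μ) :
    g.1 ((rowCycle μ ^ t) x) = (rowCycle μ ^ t) (g.1 x) := by
  have h : Commute (rowCycle μ) g.1 := Subgroup.mem_centralizer_singleton_iff.1 g.2 |>.symm
  have := (h.pow_left t).eq
  exact (congrArg (fun f : Equiv.Perm (CyclicRows μ) => f x) this).symm

theorem rowCycle_pow_eq_self (μ : YoungDiagram) (t : ℕ) (x : CyclicRows μ) :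
    (rowCycle μ ^ t) x = x ↔ μ.rowLen x.1 ∣ t := by
  rw [rowCycle_pow, ← ZMod.natCast_eq_zero_iff]
  obtain ⟨i, a⟩ := x
  simp

theorem centralizer_rowLen (μ : YoungDiagram) (g : rowCentralizer μ) (x : CyclicRows μ) :
    μ.rowLen (g.1 x).1 = μ.rowLen x.1 := by
  refine Nat.dvd_antisymm ?_ ?_
  · rw [← rowCycle_pow_eq_self, ← centralizer_apply, (rowCycle_pow_eq_self _ _ _).2 dvd_rfl]
  · rw [← rowCycle_pow_eq_self, ← g.1.injective.eq_iff, centralizer_apply,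
      (rowCycle_pow_eq_self _ _ _).2 dvd_rfl]

theorem eq_pow_base (μ : YoungDiagram) (x : CyclicRows μ) :
    x = (rowCycle μ ^ (x.2.val)) ⟨x.1, 0⟩ := by
  rw [rowCycle_pow]
  obtain ⟨i, a⟩ := x
  simp

theorem rowPhase_pow (μ : YoungDiagram) (t : ℕ) (x : CyclicRows μ) :
    rowPhase μ ((rowCycle μ ^ t) x) =
      rowPhase μ x * Complex.exp (2 * Real.pi * Complex.I * t / μ.rowLen x.1) := by
  rw [rowCycle_pow]
  simp only [rowPhase]
  rw [AddChar.map_add_eq_mul]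
  congr 1
  have := ZMod.stdAddChar_coe (N := μ.rowLen x.1) (t : ℤ)
  push_cast at this
  exact this

theorem centralizer_fst (μ : YoungDiagram) (g : rowCentralizer μ) (x : CyclicRows μ) :
    (g.1 x).1 = (g.1 ⟨x.1, 0⟩).1 := by
  conv_lhs => rw [eq_pow_base μ x, centralizer_apply, rowCycle_pow]

theorem rowPhase_centralizer (μ : YoungDiagram) (g : rowCentralizer μ) (x : CyclicRows μ) :
    rowPhase μ (g.1 x) = rowPhase μ (g.1 ⟨x.1, 0⟩) * rowPhase μ x := by
  conv_lhs => rw [eq_pow_base μ x, centralizer_apply, rowPhase_pow, centralizer_rowLen]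
  have h : rowPhase μ x =
      Complex.exp (2 * Real.pi * Complex.I * (x.2.val : ℕ) / μ.rowLen x.1) := by
    conv_lhs => rw [eq_pow_base μ x, rowPhase_pow, rowPhase_zero, one_mul]
  rw [h]

/-- The linear character of `Z_μ` that is trivial on permutations of rows of equal length and
a primitive character on the cyclic group of each row. For `g ∈ Z_μ` that maps the origin of row
`i` to the element `a_i` of some row of length `μ_i`, its value is `∏ i, exp (2 π i a_i / μ_i)`. -/
def centralizerChar (μ : YoungDiagram) : rowCentralizer μ →* ℂ where
  toFun g := ∏ i : Fin (μ.colLen 0), rowPhase μ (g.1 ⟨i, 0⟩)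
  map_one' := Finset.prod_eq_one fun i _ => rowPhase_zero μ i
  map_mul' g h := by
    have hb : Function.Bijective fun i : Fin (μ.colLen 0) => (h.1 ⟨i, 0⟩).1 := by
      rw [← Finite.surjective_iff_bijective]
      intro k
      refine ⟨(h.1.symm ⟨k, 0⟩).1, ?_⟩
      simp only
      rw [← centralizer_fst, Equiv.apply_symm_apply]
    have h1 : ∏ i : Fin (μ.colLen 0), rowPhase μ (g.1 ⟨i, 0⟩) =
        ∏ i : Fin (μ.colLen 0), rowPhase μ (g.1 ⟨(h.1 ⟨i, 0⟩).1, 0⟩) :=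
      (hb.prod_comp fun i => rowPhase μ (g.1 ⟨i, 0⟩)).symm
    rw [h1, ← Finset.prod_mul_distrib]
    refine Finset.prod_congr rfl fun i _ => ?_
    rw [← rowPhase_centralizer]
    rfl

/-- `Z_μ` as a subgroup of `S_n`: an injective homomorphism `Z_μ → S_n`, given by a numbering of
the cells. -/
def centralizerHom {n : ℕ} (μ : Diagram n) : rowCentralizer μ.1 →* Equiv.Perm (Fin n) :=
  (Equiv.permCongrHom (Fintype.equivFinOfCardEq (card_cyclicRows μ))).toMonoidHom.comp
    (rowCentralizer μ.1).subtype

/-- The one-dimensional representation of `Z_μ` with character `centralizerChar μ`. -/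
def centralizerRep (μ : YoungDiagram) : Representation ℂ (rowCentralizer μ) ℂ :=
  (Algebra.lmul ℂ ℂ).toRingHom.toMonoidHom.comp (centralizerChar μ)

/-- The higher Lie character `ψ^μ` of `S_n`, induced from the linear character of `Z_μ`. -/
def higherLieChar {n : ℕ} (μ : Diagram n) : Equiv.Perm (Fin n) → ℂ :=
  (Representation.ind (centralizerHom μ) (centralizerRep μ.1)).character

/-! ### The Plancherel measure -/

open Classical in
/-- The number of standard Young tableaux of shape `α`, that is, of chains
`∅ = α⁽⁰⁾ ⊂ α⁽¹⁾ ⊂ … ⊂ α⁽ⁿ⁾ = α` of diagrams with `|α⁽ⁱ⁾| = i`. -/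
def numSYT : (n : ℕ) → Diagram n → ℕ
  | 0, _ => 1
  | n + 1, α => ∑ β : Diagram n with β.1 ≤ α.1, numSYT n β

theorem notMem_of_rowLen (μ : YoungDiagram) (i : ℕ) : (i, μ.rowLen i) ∉ μ := by
  rw [YoungDiagram.mem_iff_lt_rowLen]; exact lt_irrefl _

/-- The rows of `μ` from which a cell can be removed. -/
def removable (μ : YoungDiagram) : Finset ℕ :=
  (Finset.range (μ.colLen 0)).filter fun i => μ.rowLen (i + 1) < μ.rowLen i

theorem mem_removable (μ : YoungDiagram) (i : ℕ) :
    i ∈ removable μ ↔ μ.rowLen (i + 1) < μ.rowLen i := by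
  simp only [removable, Finset.mem_filter, Finset.mem_range, and_iff_right_iff_imp]
  intro h
  exact YoungDiagram.mem_iff_lt_colLen.1 (YoungDiagram.mem_iff_lt_rowLen.2 (by omega))

/-- The rows of `μ` to which a cell can be added. -/
def addable (μ : YoungDiagram) : Finset ℕ :=
  insert 0 ((removable μ).image Nat.succ)

theorem card_addable (μ : YoungDiagram) : (addable μ).card = (removable μ).card + 1 := by
  rw [addable, Finset.card_insert_of_notMem, Finset.card_image_of_injective _ Nat.succ_injective]
  simp

theorem mem_addable (μ : YoungDiagram) (i : ℕ) :
    i ∈ addable μ ↔ ∀ k < i, μ.rowLen i < μ.rowLen k := by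
  cases i with
  | zero => simp [addable]
  | succ i =>
    simp only [addable, Finset.mem_insert, Finset.mem_image, Nat.succ_eq_add_one,
      Nat.add_eq_zero_iff, one_ne_zero, and_false, false_or, Nat.add_right_cancel_iff,
      exists_eq_right, mem_removable]
    constructor
    · intro h k hk
      exact h.trans_le (μ.rowLen_anti k i (by omega))
    · intro h
      exact h i (by omega)

/-- Add a cell to row `i` of `α`. -/
def addCell {n : ℕ} (α : Diagram n) (i : ℕ) (hi : i ∈ addable α.1) : Diagram (n + 1) :=
  ⟨{ cells := insert (i, α.1.rowLen i) α.1.cells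
     isLowerSet := by
       rintro ⟨a, b⟩ ⟨c, d⟩ h hab
       have h1 := (Prod.mk_le_mk.1 h).1
       have h2 := (Prod.mk_le_mk.1 h).2
       simp only [Finset.coe_insert, Set.mem_insert_iff, Prod.mk.injEq, Finset.mem_coe,
         YoungDiagram.mem_cells, YoungDiagram.mem_iff_lt_rowLen] at hab ⊢
       rw [mem_addable] at hi
       rcases hab with ⟨rfl, rfl⟩ | hab
       · rcases h1.lt_or_eq with h1 | rfl
         · have := hi c h1
           omega
         · omega
       · have := α.1.rowLen_anti c a h1
         omega },
    by
      have : (i, α.1.rowLen i) ∉ α.1.cells := notMem_of_rowLen α.1 i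
      have h2 := α.2
      simp only [YoungDiagram.card] at h2 ⊢
      rw [Finset.card_insert_of_notMem this, h2]⟩

/-- Remove the last cell of row `i` of `α`. -/
def removeCell {n : ℕ} (α : Diagram (n + 1)) (i : ℕ) (hi : i ∈ removable α.1) : Diagram n :=
  ⟨{ cells := α.1.cells.erase (i, α.1.rowLen i - 1)
     isLowerSet := by
       rintro ⟨a, b⟩ ⟨c, d⟩ h hab
       have h1 := (Prod.mk_le_mk.1 h).1
       have h2 := (Prod.mk_le_mk.1 h).2
       simp only [Finset.coe_erase, Set.mem_sdiff, Set.mem_singleton_iff, Prod.mk.injEq,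
         Finset.mem_coe, YoungDiagram.mem_cells, YoungDiagram.mem_iff_lt_rowLen] at hab ⊢
       rw [mem_removable] at hi
       have h3 := α.1.rowLen_anti c a h1
       refine ⟨by omega, ?_⟩
       rintro ⟨rfl, rfl⟩
       rcases h1.lt_or_eq with h1 | rfl
       · have := α.1.rowLen_anti (c + 1) a h1
         omega
       · omega },
    by
      have : (i, α.1.rowLen i - 1) ∈ α.1.cells := by
        rw [mem_removable] at hi
        rw [YoungDiagram.mem_cells, YoungDiagram.mem_iff_lt_rowLen]
        omega
      have h2 := α.2
      simp only [YoungDiagram.card] at h2 ⊢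
      rw [Finset.card_erase_of_mem this, h2]
      rfl⟩

theorem exists_cell {n : ℕ} {β : Diagram n} {α : Diagram (n + 1)} (h : β.1 ≤ α.1) :
    ∃ c, c ∉ β.1.cells ∧ α.1.cells = insert c β.1.cells := by
  have hs : β.1.cells ⊆ α.1.cells := h
  have h1 := β.2
  have h2 := α.2
  simp only [YoungDiagram.card] at h1 h2
  have hc : (α.1.cells \ β.1.cells).card = 1 := by
    rw [Finset.card_sdiff_of_subset hs]; omega
  obtain ⟨c, hc⟩ := Finset.card_eq_one.1 hc
  refine ⟨c, ?_, ?_⟩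
  · have : c ∈ α.1.cells \ β.1.cells := by rw [hc]; exact Finset.mem_singleton_self c
    exact (Finset.mem_sdiff.1 this).2
  · rw [← Finset.sdiff_union_of_subset hs, hc]
    rfl

open Classical in
theorem card_up {n : ℕ} (α : Diagram n) :
    (Finset.univ.filter fun Λ : Diagram (n + 1) => α.1 ≤ Λ.1).card = (addable α.1).card := by
  symm
  refine Finset.card_bij (fun i hi => addCell α i hi) ?_ ?_ ?_
  · intro i hi
    simp only [Finset.mem_filter, Finset.mem_univ, true_and]
    exact Finset.subset_insert _ _
  · intro i hi k hk h
    have h1 : (i, α.1.rowLen i) ∈ (addCell α k hk).1.cells := by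
      rw [← h]; exact Finset.mem_insert_self _ _
    rcases Finset.mem_insert.1 h1 with h1 | h1
    · exact (Prod.mk.inj h1).1
    · exact absurd h1 (notMem_of_rowLen _ _)
  · intro Λ hΛ
    simp only [Finset.mem_filter, Finset.mem_univ, true_and] at hΛ
    obtain ⟨⟨i, j⟩, hc, hΛc⟩ := exists_cell hΛ
    have hmem : ∀ a b, (a, b) ∈ Λ.1 ↔ (a = i ∧ b = j) ∨ b < α.1.rowLen a := by
      intro a b
      rw [← YoungDiagram.mem_cells, hΛc, Finset.mem_insert, YoungDiagram.mem_cells,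
        YoungDiagram.mem_iff_lt_rowLen, Prod.mk.injEq]
    have hij : (i, j) ∈ Λ.1 := (hmem i j).2 (Or.inl ⟨rfl, rfl⟩)
    rw [YoungDiagram.mem_cells, YoungDiagram.mem_iff_lt_rowLen] at hc
    have hj : j = α.1.rowLen i := by
      have := (hmem i (α.1.rowLen i)).1 (Λ.1.up_left_mem le_rfl (by omega) hij)
      omega
    have hi : i ∈ addable α.1 := by
      rw [mem_addable]
      intro k hk
      have := (hmem k j).1 (Λ.1.up_left_mem hk.le le_rfl hij)
      omega
    refine ⟨i, hi, Subtype.ext (YoungDiagram.ext ?_)⟩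
    rw [hΛc, hj]
    rfl

open Classical in
theorem card_down {n : ℕ} (α : Diagram (n + 1)) :
    (Finset.univ.filter fun β : Diagram n => β.1 ≤ α.1).card = (removable α.1).card := by
  symm
  refine Finset.card_bij (fun i hi => removeCell α i hi) ?_ ?_ ?_
  · intro i hi
    simp only [Finset.mem_filter, Finset.mem_univ, true_and]
    exact Finset.erase_subset _ _
  · intro i hi k hk h
    have h1 : (i, α.1.rowLen i - 1) ∉ (removeCell α k hk).1.cells := by
      rw [← h]; exact Finset.notMem_erase _ _
    by_contra hne
    apply h1
    refine Finset.mem_erase.2 ⟨fun h => hne (Prod.mk.inj h).1, ?_⟩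
    rw [mem_removable] at hi
    rw [YoungDiagram.mem_cells, YoungDiagram.mem_iff_lt_rowLen]
    omega
  · intro β hβ
    simp only [Finset.mem_filter, Finset.mem_univ, true_and] at hβ
    obtain ⟨⟨i, j⟩, hc, hαc⟩ := exists_cell hβ
    have hmem : ∀ a b, b < α.1.rowLen a ↔ (a = i ∧ b = j) ∨ (a, b) ∈ β.1 := by
      intro a b
      rw [← YoungDiagram.mem_iff_lt_rowLen, ← YoungDiagram.mem_cells, hαc, Finset.mem_insert,
        YoungDiagram.mem_cells, Prod.mk.injEq]
    have hij : j < α.1.rowLen i := (hmem i j).2 (Or.inl ⟨rfl, rfl⟩)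
    have hj : j = α.1.rowLen i - 1 := by
      by_contra hne
      rcases (hmem i (α.1.rowLen i - 1)).1 (by omega) with h | h
      · omega
      · exact hc (β.1.up_left_mem le_rfl (by omega) h)
    have hi : i ∈ removable α.1 := by
      rw [mem_removable]
      by_contra hle
      rcases (hmem (i + 1) j).1 (by omega) with h | h
      · omega
      · exact hc (β.1.up_left_mem (Nat.le_succ i) le_rfl h)
    refine ⟨i, hi, Subtype.ext (YoungDiagram.ext ?_)⟩
    change α.1.cells.erase (i, α.1.rowLen i - 1) = β.1.cells
    rw [hαc, ← hj, Finset.erase_insert hc]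

open Classical in
theorem card_up_common {n : ℕ} (α β : Diagram (n + 1)) :
    (Finset.univ.filter fun Λ : Diagram (n + 2) => α.1 ≤ Λ.1 ∧ β.1 ≤ Λ.1).card =
      (Finset.univ.filter fun γ : Diagram n => γ.1 ≤ α.1 ∧ γ.1 ≤ β.1).card +
        if β = α then 1 else 0 := by
  split_ifs with h
  · subst h
    simp only [and_self]
    rw [card_up, card_down, card_addable]
  · have hcard := Finset.card_union_add_card_inter α.1.cells β.1.cells
    have h1 := α.2
    have h2 := β.2
    simp only [YoungDiagram.card] at h1 h2
    have hlt : (α.1.cells ∩ β.1.cells).card < n + 1 := by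
      refine lt_of_lt_of_eq ?_ h1
      refine Finset.card_lt_card ⟨Finset.inter_subset_left, fun hs => h ?_⟩
      have hsub : α.1.cells ⊆ β.1.cells := fun x hx => (Finset.mem_inter.1 (hs hx)).2
      exact (Subtype.ext (YoungDiagram.ext (Finset.eq_of_subset_of_card_le hsub (by omega)))).symm
    rw [add_zero]
    by_cases hn : (α.1.cells ∩ β.1.cells).card = n
    · have hs : (α.1 ⊔ β.1).card = n + 2 := by
        simp only [YoungDiagram.card, YoungDiagram.cells_sup]; omega
      have hi : (α.1 ⊓ β.1).card = n := by
        simp only [YoungDiagram.card, YoungDiagram.cells_inf]; omega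
      rw [Finset.card_eq_one.2 ⟨⟨α.1 ⊔ β.1, hs⟩, ?_⟩, Finset.card_eq_one.2 ⟨⟨α.1 ⊓ β.1, hi⟩, ?_⟩]
      · ext γ
        simp only [Finset.mem_filter, Finset.mem_univ, true_and, Finset.mem_singleton]
        constructor
        · rintro ⟨ha, hb⟩
          have hsub : γ.1.cells ⊆ (α.1 ⊓ β.1).cells := le_inf ha hb
          refine Subtype.ext (YoungDiagram.ext (Finset.eq_of_subset_of_card_le hsub ?_))
          exact (hi.trans γ.2.symm).le
        · rintro rfl
          exact ⟨inf_le_left, inf_le_right⟩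
      · ext Λ
        simp only [Finset.mem_filter, Finset.mem_univ, true_and, Finset.mem_singleton]
        constructor
        · rintro ⟨ha, hb⟩
          have hsub : (α.1 ⊔ β.1).cells ⊆ Λ.1.cells := sup_le ha hb
          refine Subtype.ext (YoungDiagram.ext (Finset.eq_of_subset_of_card_le hsub ?_).symm)
          exact (Λ.2.trans hs.symm).le
        · rintro rfl
          exact ⟨le_sup_left, le_sup_right⟩
    · rw [Finset.card_eq_zero.2, Finset.card_eq_zero.2]
      · rw [Finset.filter_eq_empty_iff]
        rintro γ - ⟨ha, hb⟩
        have hsub : γ.1.cells ⊆ α.1.cells ∩ β.1.cells := Finset.subset_inter ha hb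
        have h3 := Finset.card_le_card hsub
        have h4 := γ.2
        simp only [YoungDiagram.card] at h4
        omega
      · rw [Finset.filter_eq_empty_iff]
        rintro Λ - ⟨ha, hb⟩
        have hsub : α.1.cells ∪ β.1.cells ⊆ Λ.1.cells := Finset.union_subset ha hb
        have h3 := Finset.card_le_card hsub
        have h4 := Λ.2
        simp only [YoungDiagram.card] at h4
        omega

instance : Subsingleton (Diagram 0) := by
  refine ⟨fun a b => Subtype.ext (YoungDiagram.ext ?_)⟩
  rw [Finset.card_eq_zero.1 a.2, Finset.card_eq_zero.1 b.2]

open Classical in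
theorem sum_up_eq {n : ℕ} (α : Diagram n) :
    ∑ Λ : Diagram (n + 1) with α.1 ≤ Λ.1, numSYT (n + 1) Λ =
      ∑ β : Diagram n, numSYT n β *
        (Finset.univ.filter fun Λ : Diagram (n + 1) => α.1 ≤ Λ.1 ∧ β.1 ≤ Λ.1).card := by
  simp only [numSYT, Finset.sum_filter, Finset.card_filter, Finset.mul_sum]
  symm
  rw [Finset.sum_comm]
  refine Finset.sum_congr rfl fun Λ _ => ?_
  split_ifs with h <;> simp [h]

open Classical in
/-- `∑ f^Λ = (n + 1) f^α`, summed over the diagrams `Λ` obtained by adding a cell to `α ⊢ n`. -/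
theorem sum_numSYT_up {n : ℕ} (α : Diagram n) :
    ∑ Λ : Diagram (n + 1) with α.1 ≤ Λ.1, numSYT (n + 1) Λ = (n + 1) * numSYT n α := by
  induction n with
  | zero =>
    rw [sum_up_eq, Fintype.sum_subsingleton _ α]
    simp only [and_self]
    rw [card_up, card_addable]
    have : removable α.1 = ∅ := by
      refine Finset.eq_empty_of_forall_notMem fun i hi => ?_
      rw [mem_removable] at hi
      exact absurd (mem_lt α (YoungDiagram.mem_iff_lt_rowLen.2 (Nat.zero_lt_of_lt hi))).1
        (Nat.not_lt_zero _)
    simp [this]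
  | succ n ih =>
    rw [sum_up_eq]
    simp only [card_up_common, mul_add, Finset.sum_add_distrib, mul_ite, mul_one, mul_zero,
      Finset.sum_ite_eq', Finset.mem_univ, if_true]
    have h : ∑ β : Diagram (n + 1), numSYT (n + 1) β *
        (Finset.univ.filter fun γ : Diagram n => γ.1 ≤ α.1 ∧ γ.1 ≤ β.1).card =
        ∑ γ : Diagram n with γ.1 ≤ α.1, (n + 1) * numSYT n γ := by
      simp only [← ih, Finset.sum_filter, Finset.card_filter, Finset.mul_sum]
      rw [Finset.sum_comm]
      refine Finset.sum_congr rfl fun γ _ => ?_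
      split_ifs with hγ <;> simp [hγ]
    rw [h, ← Finset.mul_sum, ← numSYT]
    ring

theorem numSYT_pos {n : ℕ} (α : Diagram n) : 0 < numSYT n α := by
  classical
  induction n with
  | zero => simp [numSYT]
  | succ n ih =>
    rw [numSYT]
    refine Finset.sum_pos (fun β _ => ih β) ?_
    rw [← Finset.card_pos, card_down, Finset.card_pos]
    by_contra hne
    rw [Finset.not_nonempty_iff_eq_empty] at hne
    have hall : ∀ i, α.1.rowLen 0 ≤ α.1.rowLen i := by
      intro i
      induction i with
      | zero => exact le_rfl
      | succ i hi =>
        have : i ∉ removable α.1 := by simp [hne]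
        rw [mem_removable] at this
        omega
    have hcard := α.2
    have hne2 : α.1.cells.Nonempty := by
      rw [← Finset.card_pos]
      exact Nat.lt_of_lt_of_eq (Nat.succ_pos n) hcard.symm
    obtain ⟨⟨i, j⟩, hij⟩ := hne2
    have h0 : (0, 0) ∈ α.1 := α.1.up_left_mem (Nat.zero_le i) (Nat.zero_le j) hij
    have h1 : (n + 1, 0) ∈ α.1 := by
      rw [YoungDiagram.mem_iff_lt_rowLen] at h0 ⊢
      exact h0.trans_le (hall _)
    exact absurd (mem_lt α h1).1 (lt_irrefl _)

open Classical in
/-- The conditional law of `ν⁽ⁿ⁺¹⁾` given `ν⁽ⁿ⁾ = α`: the diagram `Λ ⊃ α` has probability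
`f^Λ / ((n + 1) f^α)`. -/
def plancherelStep {n : ℕ} (α : Diagram n) : PMF (Diagram (n + 1)) :=
  PMF.ofFintype
    (fun Λ => if α.1 ≤ Λ.1 then (numSYT (n + 1) Λ : ℝ≥0∞) / ((n + 1) * numSYT n α : ℕ) else 0)
    (by
      rw [← Finset.sum_filter]
      simp only [div_eq_mul_inv]
      rw [← Finset.sum_mul, ← Nat.cast_sum, sum_numSYT_up, ENNReal.mul_inv_cancel]
      · have := numSYT_pos α
        exact_mod_cast (by positivity : (n + 1) * numSYT n α ≠ 0)
      · exact ENNReal.natCast_ne_top _)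

/-- `plancherelStep` as a Markov kernel from initial segments of sequences of diagrams. -/
def plancherelKernel (n : ℕ) :
    Kernel ((i : Finset.Iic n) → Diagram i) (Diagram (n + 1)) :=
  (Kernel.ofFunOfCountable fun α : Diagram n => (plancherelStep α).toMeasure).comap
    (fun h => h ⟨n, Finset.mem_Iic.2 le_rfl⟩) (measurable_pi_apply _)

instance (n : ℕ) : IsMarkovKernel (plancherelKernel n) := by
  refine ⟨fun h => ?_⟩
  rw [plancherelKernel, Kernel.comap_apply]
  exact PMF.toMeasure.isProbabilityMeasure _

/-- The Plancherel measure on infinite sequences `ν = (ν⁽⁰⁾, ν⁽¹⁾, …)` of Young diagrams with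
`|ν⁽ⁿ⁾| = n`. It is supported on increasing sequences, and an increasing initial segment
`(ν⁽⁰⁾, …, ν⁽ⁿ⁾)` has probability `f^{ν⁽ⁿ⁾} / n!`; see `plancherel_cylinder`. -/
def plancherel : Measure ((n : ℕ) → Diagram n) :=
  Kernel.trajMeasure (Measure.dirac emptyDiagram) plancherelKernel

instance : IsProbabilityMeasure plancherel := by
  rw [plancherel]; infer_instance

open Classical in
theorem plancherel_cylinder (τ : (n : ℕ) → Diagram n) (n : ℕ) :
    plancherel {ν | ∀ i ≤ n, ν i = τ i} =
      if ∀ i < n, (τ i).1 ≤ (τ (i + 1)).1 then (numSYT n (τ n) : ℝ≥0∞) / n.factorial else 0 := by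
  induction n with
  | zero =>
    have : {ν : (n : ℕ) → Diagram n | ∀ i ≤ 0, ν i = τ i} = Set.univ := by
      refine Set.eq_univ_of_forall fun ν i hi => ?_
      obtain rfl := Nat.le_zero.1 hi
      exact Subsingleton.elim _ _
    rw [this]
    simp [numSYT]
  | succ n ih =>
    let A : Set ((i : Finset.Iic n) → Diagram i) := {h | ∀ i, h i = τ i}
    have hA : MeasurableSet A := by
      have : A = ⋂ i, (fun h : (i : Finset.Iic n) → Diagram i => h i) ⁻¹' {τ i} := by
        ext h; simp [A]
      rw [this]
      exact MeasurableSet.iInter fun i => measurable_pi_apply i (measurableSet_singleton _)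
    have hmeas : Measurable fun x : (n : ℕ) → Diagram n =>
        (Preorder.frestrictLe (π := fun n => Diagram n) n x, x (n + 1)) := by fun_prop
    have hset : {ν : (n : ℕ) → Diagram n | ∀ i ≤ n + 1, ν i = τ i} =
        (fun x : (n : ℕ) → Diagram n =>
          (Preorder.frestrictLe (π := fun n => Diagram n) n x, x (n + 1))) ⁻¹'
          (A ×ˢ {τ (n + 1)}) := by
      ext ν
      simp only [Set.mem_ofPred_eq, Set.mem_preimage, Set.mem_prod, Set.mem_singleton_iff, A,
        Preorder.frestrictLe_apply, Subtype.forall, Finset.mem_Iic]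
      constructor
      · exact fun h => ⟨fun i hi => h i (by omega), h _ le_rfl⟩
      · rintro ⟨h1, h2⟩ i hi
        rcases Nat.lt_or_eq_of_le hi with hi | rfl
        · exact h1 i (by omega)
        · exact h2
    have hset2 : {ν : (n : ℕ) → Diagram n | ∀ i ≤ n, ν i = τ i} =
        Preorder.frestrictLe (π := fun n => Diagram n) n ⁻¹' A := by
      ext ν
      simp [A]
    have hstep : ∀ h ∈ A, plancherelKernel n h {τ (n + 1)} =
        plancherelStep (τ n) (τ (n + 1)) := by
      intro h hh
      rw [plancherelKernel, Kernel.comap_apply, Kernel.ofFunOfCountable, Kernel.coe_mk,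
        PMF.toMeasure_apply_singleton _ _ (measurableSet_singleton _), hh]
    rw [hset, ← Measure.map_apply hmeas (hA.prod (measurableSet_singleton _)), plancherel,
      ← Kernel.map_frestrictLe_trajMeasure_compProd_eq_map_trajMeasure,
      Measure.compProd_apply_prod hA (measurableSet_singleton _),
      setLIntegral_congr_fun hA hstep, setLIntegral_const,
      Measure.map_apply (by fun_prop) hA, ← hset2, ← plancherel, ih]
    have hsplit : (∀ i < n + 1, (τ i).1 ≤ (τ (i + 1)).1) ↔
        (∀ i < n, (τ i).1 ≤ (τ (i + 1)).1) ∧ (τ n).1 ≤ (τ (n + 1)).1 := Nat.forall_lt_succ_right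
    simp only [hsplit, plancherelStep, PMF.ofFintype_apply]
    by_cases h1 : (τ n).1 ≤ (τ (n + 1)).1
    · by_cases h2 : ∀ i < n, (τ i).1 ≤ (τ (i + 1)).1
      · rw [if_pos h1, if_pos h2, if_pos ⟨h2, h1⟩]
        have hpos : (numSYT n (τ n) : ℝ≥0∞) ≠ 0 := by
          exact_mod_cast (numSYT_pos (τ n)).ne'
        rw [Nat.factorial_succ, Nat.cast_mul, Nat.cast_mul, div_eq_mul_inv, div_eq_mul_inv,
          div_eq_mul_inv, ENNReal.mul_inv (Or.inr (ENNReal.natCast_ne_top _)) (Or.inr hpos),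
          ENNReal.mul_inv (Or.inr (ENNReal.natCast_ne_top _))
            (Or.inr (by exact_mod_cast n.factorial_ne_zero))]
        calc _ = (numSYT (n + 1) (τ (n + 1)) : ℝ≥0∞) * ((((n + 1 : ℕ) : ℝ≥0∞))⁻¹ *
              ((n.factorial : ℝ≥0∞))⁻¹) *
              ((numSYT n (τ n) : ℝ≥0∞)⁻¹ * (numSYT n (τ n) : ℝ≥0∞)) := by ring
          _ = _ := by rw [ENNReal.inv_mul_cancel hpos (ENNReal.natCast_ne_top _), mul_one]
      · rw [if_neg h2, mul_zero, if_neg fun h => h2 h.1]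
    · rw [if_neg h1, zero_mul, if_neg fun h => h1 h.2]

/-! ### Tending to be regular -/

/-- For `N k → ∞`, a sequence of characters `ρ k` of `S_{N k}` is asymptotically regular along
the sequence of diagrams `ν` if `⟨ρ k, χ^{ν⁽ᴺ⁾}⟩ / dim (ρ k) ∼ f^{ν⁽ᴺ⁾} / N!` as `k → ∞`, where
`N = N k` and `f^ν = dim χ^ν`. -/
def RegularAlong {N : ℕ → ℕ} (ρ : (k : ℕ) → Equiv.Perm (Fin (N k)) → ℂ)
    (ν : (n : ℕ) → Diagram n) : Prop :=
  (fun k => charInner (ρ k) (irrChar (ν (N k))) / ρ k 1) ~[atTop]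
    fun k => irrChar (ν (N k)) 1 / ((N k).factorial : ℂ)

/-- A sequence of characters tends to be regular if it is asymptotically regular along
Plancherel-almost every sequence of diagrams. -/
def TendsToBeRegular {N : ℕ → ℕ} (ρ : (k : ℕ) → Equiv.Perm (Fin (N k)) → ℂ) : Prop :=
  ∀ᵐ ν ∂plancherel, RegularAlong ρ ν

end HigherLie

end

/-!
The asymptotic relation fails along every sequence of diagrams, not only almost every one, by
comparing the size of a multiplicity with its integrality.

Let `n = 2k`, let `f` be the dimension of the Specht module of a diagram `ν` with `n` cells, let `d`
be the degree of the higher Lie character of `(2 ^ k)`, and let `a` be the inner product of the two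
characters. The relation says that `a` is asymptotic to `f * d / n!`.

* `a` is a natural number, being the dimension of a space of intertwining maps
  (`exists_charInner_eq_natCast`).
* The centralizer of a fixed-point-free involution has order `2 ^ k * k!`, so
  `d ≤ n! / (2 ^ k * k!)` (`finrank_higherLie_mul_le`).
* `0 < f` and `f ^ 2 ≤ n!` (`finrank_spechtModule_sq_le`), because the Specht module is simple: the
  Young symmetrizer `c = a_ν * b_ν` is not zero, and von Neumann's lemma gives `a_ν x b_ν ∈ ℂ c` for
  every `x` in the group algebra (`rowSum_mul_mul_colSum`). The bound on the dimension of a simple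
  module follows from Schur's lemma and the density theorem.

Hence `f * d / n!` is positive and at most `√n! / (2 ^ k * k!) = √(centralBinom k / 4 ^ k)`, which is
less than `1 / 2` for `k ≥ 5`. No natural number is within a factor close to `1` of such a number.
-/

/-! ### Simple modules over semisimple algebras -/

section Algebra

/-- If `c * A * c` consists of scalar multiples of `c`, then the left ideal `A * c` of a semisimple
algebra `A` is simple: a smaller ideal `J` has `c * J = 0`, hence `J * J = 0`, and a left ideal of
square zero vanishes because it is generated by an idempotent. -/
theorem isSimpleModule_span_singleton {k A : Type*} [Field k] [Ring A] [Algebra k A]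
    [IsSemisimpleRing A] {c : A} (hc : c ≠ 0) (h : ∀ x, ∃ s : k, c * x * c = s • c) :
    IsSimpleModule A (Ideal.span {c} : Ideal A) := by
  rw [isSimpleModule_iff_isAtom]
  refine ⟨fun h0 => hc (by simpa using h0), fun J hJ => ?_⟩
  have hcJ : ∀ j ∈ J, c * j = 0 := by
    intro j hj
    obtain ⟨x, rfl⟩ := Ideal.mem_span_singleton'.1 (hJ.le hj)
    obtain ⟨s, hs⟩ := h x
    rw [← mul_assoc, hs]
    by_contra hne
    have hs0 : s ≠ 0 := fun h0 => hne (by rw [h0, zero_smul])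
    refine hJ.not_ge ((Ideal.span_singleton_le_iff_mem _).2 ?_)
    have h1 : c = (algebraMap k A s⁻¹ * c) * (x * c) := by
      rw [mul_assoc, ← mul_assoc c, hs, ← Algebra.smul_def, smul_smul, inv_mul_cancel₀ hs0,
        one_smul]
    rw [h1]
    exact J.smul_mem _ hj
  obtain ⟨e, he, rfl⟩ := IsSemisimpleRing.ideal_eq_span_idempotent J
  have heJ : e ∈ Ideal.span {e} := Ideal.mem_span_singleton_self e
  obtain ⟨y, hy⟩ := Ideal.mem_span_singleton'.1 (hJ.le heJ)
  have : e = 0 := by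
    rw [← he.eq]
    nth_rw 1 [← hy]
    rw [mul_assoc, hcJ e heJ, mul_zero]
  simp [this]

/-- By Schur's lemma and the density theorem, an algebra over an algebraically closed field acts on
a finite-dimensional simple module `V` through all of `End V`. -/
theorem IsSimpleModule.finrank_sq_le (k A V : Type*) [Field k] [IsAlgClosed k] [Ring A]
    [Algebra k A] [FiniteDimensional k A] [AddCommGroup V] [Module k V] [Module A V]
    [IsScalarTower k A V] [IsSimpleModule A V] [FiniteDimensional k V] :
    Module.finrank k V ^ 2 ≤ Module.finrank k A := by
  have hsurj : Function.Surjective (Algebra.lsmul k k V : A →ₐ[k] Module.End k V) := by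
    intro T
    -- Every endomorphism of the `A`-module `V` is a scalar, so `T` commutes with it.
    have hT : ∀ (g : Module.End A V) (v : V), T (g v) = g (T v) := by
      intro g v
      obtain ⟨s, rfl⟩ := (IsSimpleModule.algebraMap_end_bijective_of_isAlgClosed k).2 g
      simp
    let f : Module.End (Module.End A V) V :=
      { toFun := T, map_add' := T.map_add, map_smul' := hT }
    classical
    let b := Module.finBasis k V
    obtain ⟨r, hr⟩ := jacobson_density f (Finset.univ.image b)
    refine ⟨r, b.ext fun i => ?_⟩
    exact (hr (b i) (Finset.mem_image_of_mem _ (Finset.mem_univ i))).symm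
  have h := LinearMap.finrank_le_finrank_of_surjective
    (f := (Algebra.lsmul k k V : A →ₐ[k] Module.End k V).toLinearMap) hsurj
  rwa [Module.finrank_linearMap, ← sq] at h

end Algebra

namespace HigherLie

/-! ### Young symmetrizers -/

/-- The permutations that preserve every fibre of `f`. -/
def fiberSubgroup {α β : Type*} (f : α → β) : Subgroup (Equiv.Perm α) where
  carrier := {p | ∀ x, f (p x) = f x}
  mul_mem' := fun {p q} hp hq x => by rw [Equiv.Perm.mul_apply, hp, hq]
  one_mem' := fun _ => rfl
  inv_mem' := fun {p} hp x => by
    rw [← hp (p⁻¹ x)]; simp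

theorem swap_mem_fiberSubgroup {α β : Type*} [DecidableEq α] {f : α → β} {x y : α}
    (h : f x = f y) : Equiv.swap x y ∈ fiberSubgroup f := by
  intro z
  by_cases hx : z = x
  · rw [hx, Equiv.swap_apply_left, h]
  by_cases hy : z = y
  · rw [hy, Equiv.swap_apply_right, h]
  rw [Equiv.swap_apply_of_ne_of_ne hx hy]

variable {n : ℕ} (ν : Diagram n)

/-- The row of the label `x` in the filling of `ν`. -/
noncomputable def labelRow (x : Fin n) : ℕ := ((filling ν).symm x).1.1

/-- The column of the label `x` in the filling of `ν`. -/
noncomputable def labelCol (x : Fin n) : ℕ := ((filling ν).symm x).1.2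

theorem label_mem (x : Fin n) : (labelRow ν x, labelCol ν x) ∈ ν.1 :=
  ((filling ν).symm x).2

theorem label_ext {x y : Fin n} (hr : labelRow ν x = labelRow ν y)
    (hc : labelCol ν x = labelCol ν y) : x = y :=
  (filling ν).symm.injective (Subtype.ext (Prod.ext hr hc))

theorem exists_label {i j : ℕ} (h : (i, j) ∈ ν.1) :
    ∃ x, labelRow ν x = i ∧ labelCol ν x = j :=
  ⟨filling ν ⟨(i, j), h⟩, by simp [labelRow], by simp [labelCol]⟩

/-- If `d = labelCol ν ∘ σ` is injective on every row, then its values on a row are columns of that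
row. For every `L`, the row `i` has at most `min L (rowLen i)` labels with `d < L` and exactly that
many with column less than `L`. Since `d` is the column function up to a permutation of the labels,
the two counts have the same sum over `i`, so they agree for every row. -/
theorem lt_rowLen_of_injOn_rows (σ : Equiv.Perm (Fin n))
    (h : ∀ x y, labelRow ν x = labelRow ν y → labelCol ν (σ x) = labelCol ν (σ y) → x = y)
    (x : Fin n) : labelCol ν (σ x) < ν.1.rowLen (labelRow ν x) := by
  set L := ν.1.rowLen (labelRow ν x) with hL
  let D : ℕ → Finset (Fin n) := fun i =>
    Finset.univ.filter fun y => labelRow ν y = i ∧ labelCol ν (σ y) < L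
  let C : ℕ → Finset (Fin n) := fun i =>
    Finset.univ.filter fun y => labelRow ν y = i ∧ labelCol ν y < L
  have hle : ∀ i, (D i).card ≤ (C i).card := by
    intro i
    by_cases hi : ν.1.rowLen i ≤ L
    · refine Finset.card_le_card fun y hy => ?_
      simp only [D, C, Finset.mem_filter, Finset.mem_univ, true_and] at hy ⊢
      refine ⟨hy.1, lt_of_lt_of_le ?_ hi⟩
      rw [← hy.1]
      exact YoungDiagram.mem_iff_lt_rowLen.1 (label_mem ν y)
    · have h1 : (D i).card ≤ L := by
        rw [← Finset.card_range L]
        refine Finset.card_le_card_of_injOn (fun y => labelCol ν (σ y)) ?_ ?_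
        · intro y hy
          have := (Finset.mem_filter.1 hy).2.2
          simpa using this
        · intro y hy z hz hyz
          exact h y z ((Finset.mem_filter.1 hy).2.1.trans (Finset.mem_filter.1 hz).2.1.symm) hyz
      have h2 : L ≤ (C i).card := by
        rw [← Finset.card_range L]
        refine Finset.card_le_card_of_surjOn (fun y => labelCol ν y) ?_
        intro j hj
        have hj' : j < L := by simpa using hj
        obtain ⟨y, hy1, hy2⟩ := exists_label ν
          (YoungDiagram.mem_iff_lt_rowLen.2 (by omega) : (i, j) ∈ ν.1)
        exact ⟨y, by simp [C, hy1, hy2, hj'], hy2⟩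
      exact h1.trans h2
  have hfib : ∀ (p : Fin n → Prop) [DecidablePred p], (Finset.univ.filter p).card =
      ∑ i ∈ Finset.range n, (Finset.univ.filter fun y => labelRow ν y = i ∧ p y).card := by
    intro p _
    rw [Finset.card_eq_sum_card_fiberwise (f := labelRow ν) (t := Finset.range n)]
    · refine Finset.sum_congr rfl fun i _ => ?_
      rw [Finset.filter_filter]
      simp only [and_comm]
    · intro y _
      simpa using (mem_lt ν (label_mem ν y)).1
  have hsum : ∑ i ∈ Finset.range n, (D i).card = ∑ i ∈ Finset.range n, (C i).card := by
    refine (hfib fun y => labelCol ν (σ y) < L).symm.trans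
      (Eq.trans ?_ (hfib fun y => labelCol ν y < L))
    refine Finset.card_bij (fun y _ => σ y) ?_ (fun _ _ _ _ e => σ.injective e) ?_
    · intro y hy
      simpa using hy
    · intro y hy
      exact ⟨σ⁻¹ y, by simpa using hy, by simp⟩
  have heq := (Finset.sum_eq_sum_iff_of_le fun i _ => hle i).1 hsum (labelRow ν x)
    (by simpa using (mem_lt ν (label_mem ν x)).1)
  -- In the row of `x` all columns are less than `L`, so `D` is the whole row.
  have hsub : D (labelRow ν x) ⊆ C (labelRow ν x) := by
    intro y hy
    have hy1 := (Finset.mem_filter.1 hy).2.1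
    refine Finset.mem_filter.2 ⟨Finset.mem_univ _, hy1, ?_⟩
    rw [hL, ← hy1]
    exact YoungDiagram.mem_iff_lt_rowLen.1 (label_mem ν y)
  have hDC := Finset.eq_of_subset_of_card_le hsub heq.ge
  have hx : x ∈ C (labelRow ν x) := Finset.mem_filter.2
    ⟨Finset.mem_univ _, rfl, YoungDiagram.mem_iff_lt_rowLen.1 (label_mem ν x)⟩
  rw [← hDC] at hx
  exact (Finset.mem_filter.1 hx).2.2

/-- A permutation `σ` that never moves two labels of one column into one row is the product of
a row-preserving and a column-preserving permutation. -/
theorem exists_eq_row_mul_col (σ : Equiv.Perm (Fin n))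
    (h : ∀ x y, labelRow ν x = labelRow ν y → labelCol ν (σ⁻¹ x) = labelCol ν (σ⁻¹ y) → x = y) :
    ∃ p ∈ fiberSubgroup (labelRow ν), ∃ q ∈ fiberSubgroup (labelCol ν), σ = p * q := by
  have hlt := lt_rowLen_of_injOn_rows ν σ⁻¹ h
  -- `f x` is the label in the row of `x` and in the column of `σ⁻¹ x`.
  choose f hf1 hf2 using fun x =>
    exists_label ν (YoungDiagram.mem_iff_lt_rowLen.2 (hlt x))
  have hinj : Function.Injective f := by
    intro x y hxy
    exact h x y (by rw [← hf1 x, hxy, hf1]) (by rw [← hf2 x, hxy, hf2])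
  let p : Equiv.Perm (Fin n) := Equiv.ofBijective f (Finite.injective_iff_bijective.1 hinj)
  have hp : p ∈ fiberSubgroup (labelRow ν) := hf1
  refine ⟨p⁻¹, inv_mem hp, p * σ, fun x => ?_, by simp⟩
  exact (hf2 (σ x)).trans (by simp)

open Classical in
theorem rowSum_eq : rowSum ν = ∑ p : Equiv.Perm (Fin n) with p ∈ fiberSubgroup (labelRow ν),
    MonoidAlgebra.single p 1 := by
  rw [rowSum]
  exact Finset.sum_congr (Finset.filter_congr fun _ _ => Iff.rfl) fun _ _ => rfl

open Classical in
theorem colSum_eq : colSum ν = ∑ q : Equiv.Perm (Fin n) with q ∈ fiberSubgroup (labelCol ν),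
    MonoidAlgebra.single q ((Equiv.Perm.sign q : ℤ) : ℂ) := by
  rw [colSum]
  exact Finset.sum_congr (Finset.filter_congr fun _ _ => Iff.rfl) fun _ _ => rfl

theorem rowSum_mul_single {p : Equiv.Perm (Fin n)} (hp : p ∈ fiberSubgroup (labelRow ν)) :
    rowSum ν * MonoidAlgebra.single p 1 = rowSum ν := by
  classical
  rw [rowSum_eq, Finset.sum_mul]
  refine Finset.sum_bij (fun r _ => r * p) ?_ (fun _ _ _ _ e => mul_right_cancel e) ?_ ?_
  · intro r hr
    simp only [Finset.mem_filter, Finset.mem_univ, true_and] at hr ⊢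
    exact mul_mem hr hp
  · intro r hr
    simp only [Finset.mem_filter, Finset.mem_univ, true_and] at hr
    exact ⟨r * p⁻¹, by simpa using mul_mem hr (inv_mem hp), by simp⟩
  · intro r _
    rw [MonoidAlgebra.single_mul_single, one_mul]

theorem single_mul_colSum {q : Equiv.Perm (Fin n)} (hq : q ∈ fiberSubgroup (labelCol ν)) :
    MonoidAlgebra.single q 1 * colSum ν = ((Equiv.Perm.sign q : ℤ) : ℂ) • colSum ν := by
  classical
  rw [colSum_eq, Finset.mul_sum, Finset.smul_sum]
  refine Finset.sum_bij (fun r _ => q * r) ?_ (fun _ _ _ _ e => mul_left_cancel e) ?_ ?_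
  · intro r hr
    simp only [Finset.mem_filter, Finset.mem_univ, true_and] at hr ⊢
    exact mul_mem hq hr
  · intro r hr
    simp only [Finset.mem_filter, Finset.mem_univ, true_and] at hr
    exact ⟨q⁻¹ * r, by simpa using mul_mem (inv_mem hq) hr, by simp⟩
  · intro r _
    rw [MonoidAlgebra.single_mul_single, one_mul, MonoidAlgebra.smul_single, smul_eq_mul]
    congr 1
    rcases Int.units_eq_one_or (Equiv.Perm.sign q) with h | h <;> simp [h]

/-- If `σ` moves two labels `σ⁻¹ x ≠ σ⁻¹ y` of one column into one row, then the transposition of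
`x` and `y` is absorbed by `a_ν` on one side and changes the sign of `b_ν` on the other. -/
theorem rowSum_mul_single_mul_colSum (σ : Equiv.Perm (Fin n)) :
    ∃ s : ℂ, rowSum ν * MonoidAlgebra.single σ 1 * colSum ν = s • (rowSum ν * colSum ν) := by
  by_cases h : ∀ x y, labelRow ν x = labelRow ν y →
      labelCol ν (σ⁻¹ x) = labelCol ν (σ⁻¹ y) → x = y
  · obtain ⟨p, hp, q, hq, rfl⟩ := exists_eq_row_mul_col ν σ h
    refine ⟨((Equiv.Perm.sign q : ℤ) : ℂ), ?_⟩
    rw [← mul_one (1 : ℂ), ← MonoidAlgebra.single_mul_single, ← mul_assoc,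
      rowSum_mul_single ν hp, mul_assoc, single_mul_colSum ν hq, mul_smul_comm]
  · push Not at h
    obtain ⟨x, y, hr, hc, hne⟩ := h
    refine ⟨0, ?_⟩
    have hp : Equiv.swap x y ∈ fiberSubgroup (labelRow ν) := swap_mem_fiberSubgroup hr
    have hq : Equiv.swap (σ⁻¹ x) (σ⁻¹ y) ∈ fiberSubgroup (labelCol ν) := swap_mem_fiberSubgroup hc
    have hσ : Equiv.swap x y * σ = σ * Equiv.swap (σ⁻¹ x) (σ⁻¹ y) := by
      rw [Equiv.mul_swap_eq_swap_mul]; simp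
    have hne' : σ⁻¹ x ≠ σ⁻¹ y := fun e => hne (σ⁻¹.injective e)
    have key : rowSum ν * MonoidAlgebra.single σ 1 * colSum ν =
        -(rowSum ν * MonoidAlgebra.single σ 1 * colSum ν) := by
      calc rowSum ν * MonoidAlgebra.single σ 1 * colSum ν
          = rowSum ν * MonoidAlgebra.single (Equiv.swap x y * σ) 1 * colSum ν := by
            conv_lhs => rw [← rowSum_mul_single ν hp]
            rw [mul_assoc (rowSum ν), MonoidAlgebra.single_mul_single, one_mul]
        _ = rowSum ν * MonoidAlgebra.single σ 1 *
              (MonoidAlgebra.single (Equiv.swap (σ⁻¹ x) (σ⁻¹ y)) 1 * colSum ν) := by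
            rw [hσ, ← mul_assoc, mul_assoc (rowSum ν) (MonoidAlgebra.single σ 1),
              MonoidAlgebra.single_mul_single, one_mul]
        _ = _ := by
            rw [single_mul_colSum ν hq, Equiv.Perm.sign_swap hne']
            simp
    rw [zero_smul]
    have h2 : (2 : ℂ) • (rowSum ν * MonoidAlgebra.single σ 1 * colSum ν) = 0 := by
      rw [two_smul]
      nth_rw 1 [key]
      exact neg_add_cancel _
    exact (smul_eq_zero.1 h2).resolve_left two_ne_zero

theorem rowSum_mul_mul_colSum (x : MonoidAlgebra ℂ (Equiv.Perm (Fin n))) :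
    ∃ s : ℂ, rowSum ν * x * colSum ν = s • (rowSum ν * colSum ν) := by
  induction x using MonoidAlgebra.induction_linear with
  | zero => exact ⟨0, by simp⟩
  | add f g hf hg =>
    obtain ⟨s, hs⟩ := hf
    obtain ⟨t, ht⟩ := hg
    exact ⟨s + t, by rw [mul_add, add_mul, hs, ht, add_smul]⟩
  | single σ r =>
    obtain ⟨s, hs⟩ := rowSum_mul_single_mul_colSum ν σ
    refine ⟨r * s, ?_⟩
    have hr : MonoidAlgebra.single σ r = r • MonoidAlgebra.single σ (1 : ℂ) := by
      rw [MonoidAlgebra.smul_single, smul_eq_mul, mul_one]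
    rw [hr, mul_smul_comm, smul_mul_assoc, hs, smul_smul]

/-- The identity has coefficient `1` in the Young symmetrizer, because only the identity preserves
both the rows and the columns. -/
theorem rowSum_mul_colSum_ne_zero : rowSum ν * colSum ν ≠ 0 := by
  classical
  intro h
  have h1 : (rowSum ν * colSum ν).coeff 1 = 1 := by
    rw [rowSum_eq, colSum_eq, Finset.sum_mul_sum]
    simp only [MonoidAlgebra.single_mul_single, one_mul, MonoidAlgebra.coeff_sum,
      MonoidAlgebra.coeff_single, Finsupp.finsetSum_apply, Finsupp.single_apply]
    rw [Finset.sum_eq_single 1, Finset.sum_eq_single 1]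
    · simp
    · intro q _ hq
      rw [if_neg (by simpa using hq)]
    · intro h1
      exact absurd (Finset.mem_filter.2 ⟨Finset.mem_univ _, one_mem _⟩) h1
    · intro p hp hne
      refine Finset.sum_eq_zero fun q hq => if_neg fun hpq => hne ?_
      have hp' := (Finset.mem_filter.1 hp).2
      have hpc : p ∈ fiberSubgroup (labelCol ν) := by
        rw [eq_inv_of_mul_eq_one_left hpq]
        exact inv_mem (Finset.mem_filter.1 hq).2
      exact Equiv.ext fun x => label_ext ν (hp' x) (hpc x)
    · intro h1
      exact absurd (Finset.mem_filter.2 ⟨Finset.mem_univ _, one_mem _⟩) h1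
  rw [h] at h1
  simp at h1

instance isSimpleModule_spechtModule :
    IsSimpleModule (MonoidAlgebra ℂ (Equiv.Perm (Fin n))) (SpechtModule ν) := by
  refine isSimpleModule_span_singleton (k := ℂ) (rowSum_mul_colSum_ne_zero ν) fun x => ?_
  obtain ⟨s, hs⟩ := rowSum_mul_mul_colSum ν (colSum ν * x * rowSum ν)
  exact ⟨s, by rw [← hs]; simp only [mul_assoc]⟩

instance : FiniteDimensional ℂ (SpechtModule ν) :=
  inferInstanceAs (FiniteDimensional ℂ
    ((Ideal.span {rowSum ν * colSum ν}).restrictScalars ℂ))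

theorem finrank_spechtModule_pos : 0 < Module.finrank ℂ (SpechtModule ν) := by
  have := IsSimpleModule.nontrivial (MonoidAlgebra ℂ (Equiv.Perm (Fin n))) (SpechtModule ν)
  exact Module.finrank_pos

theorem finrank_spechtModule_sq_le : Module.finrank ℂ (SpechtModule ν) ^ 2 ≤ n.factorial := by
  refine (IsSimpleModule.finrank_sq_le ℂ (MonoidAlgebra ℂ (Equiv.Perm (Fin n)))
    (SpechtModule ν)).trans_eq ?_
  rw [Module.finrank_eq_card_basis (MonoidAlgebra.basis (Equiv.Perm (Fin n)) ℂ),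
    Fintype.card_perm, Fintype.card_fin]

end HigherLie

/-! ### The degree of an induced character -/

section Induced

variable {k G H : Type*} [Field k] [Group G] [Group H]

/-- A representation induced from a one-dimensional representation of `G` along an injective
homomorphism `G → H` is spanned by one vector for each coset of `G` in `H`. -/
theorem Representation.finrank_indV_mul_card_le [Finite H] {φ : G →* H}
    (hφ : Function.Injective φ) (ρ : Representation k G k) :
    Module.finrank k (Representation.IndV φ ρ) * Nat.card G ≤ Nat.card H := by
  have : Fintype (H ⧸ φ.range) := Fintype.ofFinite _
  let b : H ⧸ φ.range → Representation.IndV φ ρ :=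
    fun q => Representation.IndV.mk φ ρ q.out⁻¹ 1
  -- Vectors over one right coset of `G` are proportional; inverses of representatives of left cosets
  -- represent the right cosets.
  have hmk : ∀ (g : G) (h : H) (a : k), Representation.IndV.mk φ ρ (φ g * h) a =
      Representation.IndV.mk φ ρ h (ρ g⁻¹ a) := by
    intro g h a
    simp
  have hb : ∀ (q : H ⧸ φ.range) (a : k),
      Representation.IndV.mk φ ρ q.out⁻¹ a ∈ Submodule.span k (Set.range b) := by
    intro q a
    rw [← mul_one a, ← smul_eq_mul, map_smul]
    exact Submodule.smul_mem _ _ (Submodule.subset_span ⟨q, rfl⟩)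
  have hspan : ⊤ ≤ Submodule.span k (Set.range b) := by
    have hzero : (Submodule.span k (Set.range b)).mkQ = 0 := by
      refine Representation.IndV.hom_ext φ ρ fun h => LinearMap.ext fun a => ?_
      rw [LinearMap.zero_comp, LinearMap.zero_apply, LinearMap.comp_apply, Submodule.mkQ_apply,
        Submodule.Quotient.mk_eq_zero]
      obtain ⟨⟨_, g, rfl⟩, hg⟩ := QuotientGroup.mk_out_eq_mul φ.range h⁻¹
      have hh : h = φ g * (QuotientGroup.mk h⁻¹ : H ⧸ φ.range).out⁻¹ := by
        rw [hg]
        simp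
      rw [hh, hmk]
      exact hb _ _
    rw [← Submodule.ker_mkQ (Submodule.span k (Set.range b)), hzero, LinearMap.ker_zero]
  have h1 := finrank_range_le_card (R := k) b
  rw [Set.finrank, top_le_iff.1 hspan, finrank_top] at h1
  rw [Subgroup.card_eq_card_quotient_mul_card_subgroup φ.range,
    Nat.card_congr (MonoidHom.ofInjective hφ).toEquiv.symm,
    Nat.card_eq_fintype_card (α := H ⧸ φ.range)]
  exact Nat.mul_le_mul_right _ h1

end Induced

namespace HigherLie

theorem rowLen_rectangle {m k i : ℕ} (hi : i < k) : (rectangle m k).1.rowLen i = m := by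
  have h : ∀ j, j < (rectangle m k).1.rowLen i ↔ j < m := by
    intro j
    rw [← YoungDiagram.mem_iff_lt_rowLen, ← YoungDiagram.mem_cells]
    simp [rectangle, hi]
  exact le_antisymm (le_of_not_gt fun h' => lt_irrefl _ ((h _).1 h'))
    (le_of_not_gt fun h' => lt_irrefl _ ((h _).2 h'))

theorem lt_of_colLen_rectangle {m k i : ℕ} (hi : i < (rectangle m k).1.colLen 0) : i < k := by
  rw [← YoungDiagram.mem_iff_lt_colLen, ← YoungDiagram.mem_cells] at hi
  simp only [rectangle, Finset.mem_product, Finset.mem_range] at hi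
  exact hi.1

/-- The centralizer of a fixed-point-free involution is the hyperoctahedral group. -/
theorem card_rowCentralizer_rectangle_two (k : ℕ) :
    Nat.card (rowCentralizer (rectangle 2 k).1) = 2 ^ k * k.factorial := by
  have hrow : ∀ x : CyclicRows (rectangle 2 k).1, (rectangle 2 k).1.rowLen x.1 = 2 :=
    fun x => rowLen_rectangle (lt_of_colLen_rectangle x.1.2)
  set g := rowCycle (rectangle 2 k).1 with hg
  have hsq : g ^ 2 = 1 := by
    ext1 x
    rw [Equiv.Perm.one_apply, rowCycle_pow_eq_self, hrow]
  have hsupp : g.support = Finset.univ := by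
    ext x
    simp only [Equiv.Perm.mem_support, Finset.mem_univ, iff_true]
    intro h
    rw [← pow_one g, rowCycle_pow_eq_self, hrow] at h
    omega
  have hcard := card_cyclicRows (rectangle 2 k)
  have hsum := g.sum_cycleType
  rw [hsupp, Finset.card_univ, hcard] at hsum
  have : Fact (Nat.Prime 2) := ⟨Nat.prime_two⟩
  have htype := Equiv.Perm.cycleType_of_pow_prime_eq_one hsq
  have hk : g.cycleType.card = k := by
    rw [htype] at hsum
    simp only [Multiset.sum_replicate, smul_eq_mul] at hsum
    omega
  rw [hk] at htype
  rw [Equiv.Perm.nat_card_centralizer, hsum, hcard, htype]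
  rcases Nat.eq_zero_or_pos k with rfl | hk0
  · simp
  · simp [Multiset.toFinset_replicate, hk0.ne']

theorem centralizerHom_injective {n : ℕ} (μ : Diagram n) :
    Function.Injective (centralizerHom μ) :=
  fun _ _ h => Subtype.ext ((Equiv.permCongrHom _).injective h)

theorem higherLieChar_one {n : ℕ} (μ : Diagram n) : higherLieChar μ 1 =
    Module.finrank ℂ (Representation.IndV (centralizerHom μ) (centralizerRep μ.1)) :=
  Representation.char_one _

theorem finrank_higherLie_mul_le (k : ℕ) :
    Module.finrank ℂ (Representation.IndV (centralizerHom (rectangle 2 k))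
      (centralizerRep (rectangle 2 k).1)) * (2 ^ k * k.factorial) ≤ (2 * k).factorial := by
  have h := Representation.finrank_indV_mul_card_le (centralizerHom_injective (rectangle 2 k))
    (centralizerRep (rectangle 2 k).1)
  rwa [card_rowCentralizer_rectangle_two, Nat.card_eq_fintype_card, Fintype.card_perm,
    Fintype.card_fin] at h

theorem irrChar_one {n : ℕ} (ν : Diagram n) :
    irrChar ν 1 = Module.finrank ℂ (SpechtModule ν) :=
  Representation.char_one _

/-- The inner product of the characters of two representations is a natural number: it is the
dimension of the space of intertwining maps. -/
theorem exists_charInner_eq_natCast {n : ℕ} (μ ν : Diagram n) :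
    ∃ a : ℕ, charInner (higherLieChar μ) (irrChar ν) = a := by
  have : Invertible (Nat.card (Equiv.Perm (Fin n)) : ℂ) :=
    invertibleOfNonzero (Nat.cast_ne_zero.2 Nat.card_pos.ne')
  have h := Representation.card_inv_mul_sum_char_mul_char_eq_finrank (spechtRep ν)
    (Representation.ind (centralizerHom μ) (centralizerRep μ.1))
  rw [Nat.card_eq_fintype_card, Fintype.card_perm, Fintype.card_fin] at h
  exact ⟨_, h⟩

/-! ### Comparison of degrees -/

theorem four_mul_centralBinom_lt {k : ℕ} (hk : 5 ≤ k) : 4 * k.centralBinom < 4 ^ k := by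
  induction k, hk using Nat.le_induction with
  | base => decide
  | succ k _ ih =>
    have h := Nat.succ_mul_centralBinom_succ k
    have h2 : (k + 1) * (4 * (k + 1).centralBinom) < (k + 1) * 4 ^ (k + 1) := by
      rw [pow_succ]
      nlinarith
    exact lt_of_mul_lt_mul_left h2 (Nat.zero_le _)

/-- This holds because `(2k)! / (2 ^ k * k!) ^ 2 = centralBinom k / 4 ^ k < 1 / 4`. -/
theorem two_mul_lt_of_sq_le {k f : ℕ} (hk : 5 ≤ k) (hf : f ^ 2 ≤ (2 * k).factorial) :
    2 * f < 2 ^ k * k.factorial := by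
  have h1 : (2 * k).factorial = k.centralBinom * (k.factorial * k.factorial) := by
    rw [Nat.centralBinom_eq_two_mul_choose, ← mul_assoc]
    have := Nat.choose_mul_factorial_mul_factorial (n := 2 * k) (k := k) (by omega)
    rw [← this]
    congr 2
    omega
  have h2 := four_mul_centralBinom_lt hk
  have h3 : 0 < k.factorial * k.factorial := by positivity
  refine lt_of_pow_lt_pow_left₀ 2 (Nat.zero_le _) ?_
  calc (2 * f) ^ 2 = 4 * f ^ 2 := by ring
    _ ≤ 4 * (k.centralBinom * (k.factorial * k.factorial)) := by rw [← h1]; omega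
    _ = (4 * k.centralBinom) * (k.factorial * k.factorial) := by ring
    _ < 4 ^ k * (k.factorial * k.factorial) := Nat.mul_lt_mul_of_pos_right h2 h3
    _ = (2 ^ k * k.factorial) ^ 2 := by
      rw [show (4 : ℕ) = 2 ^ 2 from rfl, ← pow_mul]; ring

/-- A natural number is not close, in ratio, to a positive number less than `1 / 2`. -/
theorem half_mul_lt_abs_natCast_sub (a : ℕ) {x : ℝ} (h0 : 0 < x) (h1 : x < 1 / 2) :
    1 / 2 * x < |a - x| := by
  rcases Nat.eq_zero_or_pos a with rfl | ha
  · rw [Nat.cast_zero, zero_sub, abs_neg, abs_of_pos h0]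
    linarith
  · have : (1 : ℝ) ≤ a := by exact_mod_cast ha
    rw [abs_of_pos (by linarith)]
    linarith

/-- The relation fails along every sequence of diagrams. It would make the multiplicity `a`
asymptotic to `x = f * d / (2k)!`, but `0 < x < 1 / 2` for `k ≥ 5`. -/
theorem not_regularAlong (ν : (n : ℕ) → Diagram n) :
    ¬ RegularAlong (N := fun k => 2 * k) (fun k => higherLieChar (rectangle 2 k)) ν := by
  intro h
  have hev := (h.isLittleO.def (by norm_num : (0 : ℝ) < 1 / 2)).and (eventually_ge_atTop 5)
  obtain ⟨k, hk, hk5⟩ := hev.exists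
  simp only [Pi.sub_apply] at hk
  obtain ⟨a, ha⟩ := exists_charInner_eq_natCast (rectangle 2 k) (ν (2 * k))
  rw [ha, higherLieChar_one, irrChar_one] at hk
  have hd := finrank_higherLie_mul_le k
  have hf := finrank_spechtModule_pos (ν (2 * k))
  have hf2 := two_mul_lt_of_sq_le hk5 (finrank_spechtModule_sq_le (ν (2 * k)))
  generalize Module.finrank ℂ (Representation.IndV (centralizerHom (rectangle 2 k))
      (centralizerRep (rectangle 2 k).1)) = d at hk hd
  generalize Module.finrank ℂ (SpechtModule (ν (2 * k))) = f at hk hf hf2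
  have hN : (0 : ℝ) < (2 * k).factorial := by positivity
  have hfR : (0 : ℝ) < f := by exact_mod_cast hf
  have hk' : |(a : ℝ) / d - f / (2 * k).factorial| ≤ 1 / 2 * (f / (2 * k).factorial) := by
    have e1 : ((a : ℂ) / d - f / (2 * k).factorial) =
        (((a : ℝ) / d - f / (2 * k).factorial : ℝ) : ℂ) := by push_cast; rfl
    have e2 : ((f : ℂ) / (2 * k).factorial) = (((f : ℝ) / (2 * k).factorial : ℝ) : ℂ) := by
      push_cast; rfl
    rw [e1, e2, Complex.norm_real, Complex.norm_real, Real.norm_eq_abs, Real.norm_eq_abs,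
      abs_of_pos (div_pos hfR hN)] at hk
    exact hk
  -- If `d` were `0`, division by it would give the left side the value `0`, which is not close to
  -- the positive right side either.
  have hd0 : 0 < d := by
    rcases Nat.eq_zero_or_pos d with rfl | hd0
    · rw [Nat.cast_zero, div_zero, zero_sub, abs_neg, abs_of_pos (div_pos hfR hN)] at hk'
      have := div_pos hfR hN
      linarith
    · exact hd0
  have hdR : (0 : ℝ) < d := by exact_mod_cast hd0
  have hx1 : (f : ℝ) / (2 * k).factorial * d < 1 / 2 := by
    rw [div_mul_eq_mul_div, div_lt_iff₀ hN]
    have h1 : 2 * f * d < (2 * k).factorial :=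
      lt_of_lt_of_le (by rw [mul_comm d]; exact Nat.mul_lt_mul_of_pos_right hf2 hd0) hd
    have h2 : (2 * f * d : ℝ) < (2 * k).factorial := by exact_mod_cast h1
    linarith
  have := half_mul_lt_abs_natCast_sub a (mul_pos (div_pos hfR hN) hdR) hx1
  have e3 : (a : ℝ) - f / (2 * k).factorial * d = (a / d - f / (2 * k).factorial) * d := by
    field_simp
  rw [e3, abs_mul, abs_of_pos hdR, ← mul_assoc] at this
  exact (lt_of_mul_lt_mul_right this hdR.le).not_ge hk'

end HigherLie

theorem mainTheorem12 :
    ¬ HigherLie.TendsToBeRegular (N := fun k => 2 * k)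
        (fun k => HigherLie.higherLieChar (HigherLie.rectangle 2 k)) ∧
      ∀ᵐ ν ∂HigherLie.plancherel,
        ¬ HigherLie.RegularAlong (N := fun k => 2 * k)
          (fun k => HigherLie.higherLieChar (HigherLie.rectangle 2 k)) ν := by
  refine ⟨fun h => ?_, ae_of_all _ HigherLie.not_regularAlong⟩
  obtain ⟨ν, hν⟩ := h.exists
  exact HigherLie.not_regularAlong ν hν
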